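/- Let $L>0$ and let $a,\beta:[0,\infty)\to\mathbb R$ be bounded functions of class $C^2$ on $(0,\infty)$ which, together with their derivatives up to order two, extend continuously to $t=0$; let $a(0)>0$. Put $\gamma_0=\sqrt{2/L}$ and, for $n\ge 1$, $\lambda_n=n\pi/L$, $\phi_n(x)=\gamma_0\sin(\lambda_n x)$, and $\alpha_n=0$ if $n$ is even, $\alpha_n=2\gamma_0$ if $n$ is odd. For $\xi\in L^2(0,L)$ and boundary data $p,q$, a solution of $$\frac{d}{dt}\Big[\theta(t)+\int_0^t\beta(t-s)\theta(s)\,ds\Big]=\int_0^t a(t-s)\,\theta_{xx}(s)\,ds\quad (0<x<L,\ t\ge0),$$ $$\theta(\cdot,0)=\xi,\qquad \theta(0,t)=p(t),\qquad \theta(L,t)=q(t),$$ is understood in the weak sense: $\theta\in C([0,\infty);L^2(0,L))$, $\theta(0)=\xi$, and for every $\psi\in C^2$ with $\psi(0)=\psi(L)=0$ and every $t\ge 0$ (with a one-sided derivative at $t=0$), where $\langle u,v\rangle=\int_0^L u v\,dx$, $$\frac{d}{dt}\Big[\langle\theta(t),\psi\rangle+\int_0^t\beta(t-s)\langle\theta(s),\psi\rangle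 ds\Big]=\int_0^t a(t-s)\big[\langle\theta(s),\psi''\rangle+p(s)\psi'(0)-q(s)\psi'(L)\big]ds .$$ First experiment: let $\xi\in L^2(0,L)$ have sine coefficients $\int_0^L\xi\phi_n\,dx=1/\lambda_n$ for all $n\ge1$, let $\theta^{(1)}$ be a solution with initial datum $\xi$ and $p=q=0$, and let $H(t)=\int_0^L\theta^{(1)}(x,t)\,dx$. Second experiment: let $g$ be continuous on $[0,\infty)$, $f(t)=\int_0^t g(s)\,ds$, let $\theta^{(2)}$ be a solution with zero initial datum, $p=f$ and $q=0$, and let $\Theta(t)=\int_0^L\theta^{(2)}(x,t)\,dx$. Then: 1. $\int_0^L\phi_n(x)\,dx=\alpha_n/\lambda_n$ for all $n\ge1$. 2. $H(t)=\sum_{n\ge1}\frac{\alpha_n}{\lambda_n^2}z_n(t)$ for all $t\ge0$, with a convergent series, where $z_n$ is continuous on $[0,\infty)$ and solves $\frac{d}{dt}\big[z_n(t)+\int_0^t\beta(t-s)z_n(s)ds\big]=-\lambda_n^2\int_0^t a(t-s)z_n(s)\,ds$, $z_n(0)=1$. 3. The series $\sum_{n\ge1}\alpha_n/\lambda_n^2$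 converges, and for all $t\ge0$ $$\Theta(t)=\gamma_0\left\{\Big(\int_0^t g(s)\,ds\Big)\sum_{n=1}^\infty\frac{\alpha_n}{\lambda_n^2}-\int_0^t g(t-s)H(s)\,ds-\int_0^t\beta(s)\Big[\int_0^{t-s}g(t-s-r)H(r)\,dr\Big]ds\right\}.$$ 4. Consequently $\beta$ solves the Volterra (deconvolution) equation of the first kind $$\int_0^t\beta(s)\Big[\int_0^{t-s}g(t-s-r)H(r)\,dr\Big]ds=\Big(\int_0^t g(s)\,ds\Big)\sum_{n=1}^\infty\frac{\alpha_n}{\lambda_n^2}-\int_0^t g(t-s)H(s)\,ds-\frac{1}{\gamma_0}\Theta(t)\qquad(t\ge0),$$ in which the right-hand side is built only from $L$, the input $g$ and the measured functions $H$ and $\Theta$; the kernel $a$ does not occur in the equation. -/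

import Mathlib

open MeasureTheory Set

namespace GurtinPipkin

noncomputable section

/-- The space `L²(0,L)`. -/
abbrev L2 (L : ℝ) : Type := Lp ℝ 2 (volume.restrict (Ioo (0 : ℝ) L))

/-- Standing regularity of a relaxation kernel: bounded on `[0,∞)` and of class `C²`, with all
derivatives up to order two extending continuously to `t = 0`. -/
structure IsKernel (k : ℝ → ℝ) : Prop where
  contDiffOn : ContDiffOn ℝ 2 k (Ici 0)
  bounded : ∃ C : ℝ, ∀ t, 0 ≤ t → |k t| ≤ C

/-- `γ₀ = √(2/L)`. -/
def gamma0 (L : ℝ) : ℝ := Real.sqrt (2 / L)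

/-- `λ_n = n π / L`. -/
def lam (L : ℝ) (n : ℕ) : ℝ := n * Real.pi / L

/-- `φ_n(x) = γ₀ sin (λ_n x)`; for `n ≥ 1` these are the orthonormal Dirichlet eigenfunctions. -/
def phi (L : ℝ) (n : ℕ) (x : ℝ) : ℝ := gamma0 L * Real.sin (lam L n * x)

/-- `α_n = 0` for even `n` and `α_n = 2 γ₀` for odd `n`. -/
def alpha (L : ℝ) (n : ℕ) : ℝ := if Even n then 0 else 2 * gamma0 L

/-- `∫₀ᴸ v(x) dx`. -/
def total (L : ℝ) (v : L2 L) : ℝ := ∫ x in Ioo (0 : ℝ) L, v x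

/-- The pairing `∫₀ᴸ v(x) ψ(x) dx`. -/
def pair (L : ℝ) (v : L2 L) (ψ : ℝ → ℝ) : ℝ := ∫ x in Ioo (0 : ℝ) L, v x * ψ x

/-- `θ` is the (weak, `L²`-continuous) solution, for times `t ≥ 0`, of
`d/dt [θ(t) + ∫₀ᵗ β(t-s) θ(s) ds] = ∫₀ᵗ a(t-s) θ_xx(s) ds` on `(0,L)`
with initial condition `θ(·,0) = ξ` and boundary conditions `θ(0,t) = p(t)`, `θ(L,t) = q(t)`.
The equation is tested against all `C²` functions `ψ` with `ψ(0) = ψ(L) = 0`; two integrations by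
parts turn `∫₀ᴸ θ_xx ψ dx` into `∫₀ᴸ θ ψ'' dx + p ψ'(0) - q ψ'(L)`. -/
structure IsSolution (L : ℝ) (a β : ℝ → ℝ) (ξ : L2 L) (p q : ℝ → ℝ) (θ : ℝ → L2 L) : Prop where
  continuousOn : ContinuousOn θ (Ici 0)
  initial : θ 0 = ξ
  balance : ∀ ψ : ℝ → ℝ, ContDiff ℝ 2 ψ → ψ 0 = 0 → ψ L = 0 → ∀ t : ℝ, 0 ≤ t →
    HasDerivWithinAt
      (fun τ : ℝ => pair L (θ τ) ψ + ∫ s in (0 : ℝ)..τ, β (τ - s) * pair L (θ s) ψ)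
      (∫ s in (0 : ℝ)..t, a (t - s) *
        (pair L (θ s) (deriv (deriv ψ)) + p s * deriv ψ 0 - q s * deriv ψ L))
      (Ici 0) t

/-- `z` solves, for `t ≥ 0`,
`d/dt [z(t) + ∫₀ᵗ β(t-s) z(s) ds] = -μ² ∫₀ᵗ a(t-s) z(s) ds` with `z(0) = 1`. -/
structure IsMode (a β : ℝ → ℝ) (μ : ℝ) (z : ℝ → ℝ) : Prop where
  continuousOn : ContinuousOn z (Ici 0)
  initial : z 0 = 1
  equation : ∀ t : ℝ, 0 ≤ t →
    HasDerivWithinAt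
      (fun τ : ℝ => z τ + ∫ s in (0 : ℝ)..τ, β (τ - s) * z s)
      (-μ ^ 2 * ∫ s in (0 : ℝ)..t, a (t - s) * z s)
      (Ici 0) t

/-- The known function of the deconvolution problem. It is built only from the length `L`, the
chosen input `g`, and the two measured functions `H` (first experiment) and `Θ` (second one). -/
def knownFunction (L : ℝ) (g H Θ : ℝ → ℝ) (t : ℝ) : ℝ :=
  (∫ s in (0 : ℝ)..t, g s) * (∑' n : ℕ, alpha L (n + 1) / lam L (n + 1) ^ 2)
    - (∫ s in (0 : ℝ)..t, g (t - s) * H s)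
    - Θ t / gamma0 L

end

end GurtinPipkin

namespace GurtinPipkin

noncomputable section

/-! Write `*` for convolution on `[0,t]` and `A = 1 * a`. Testing with `φ_n` and integrating in time
turns each sine coefficient into a Volterra equation of the second kind with kernel `K = β + λ_n²
A`: the free mode satisfies `u + K * u = 1/λ_n`, the forced one `w + K * w = γ₀ λ_n A * f`.
Convolving the free equation with `g` gives `g * u + K * (g * u) = f/λ_n`. Convolving again with `γ₀
λ_n² A` reproduces the forced equation, so uniqueness yields `w = γ₀ λ_n² A * (g * u)`. But `λ_n² A
= K - β`, hence `w = γ₀ (f/λ_n - g * u - β * (g * u))`, and `a` has disappeared (`forced_mode_eq`).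
Summation over `n` is done by pairing `L²` vectors with the constant `1`, whose sine series
converges in `L²` (`hasSum_phiVec_oneVec`); its norm is checked against `ζ(2)`, so completeness of
the sines is not needed. -/

/-- The Volterra convolution `∫₀ᵗ k(t-s) v(s) ds` of a scalar kernel with a vector function. -/
def volterraConv {E : Type*} [NormedAddCommGroup E] [NormedSpace ℝ E] (k : ℝ → ℝ) (v : ℝ → E)
    (t : ℝ) : E := ∫ s in (0 : ℝ)..t, k (t - s) • v s

/-- The extension of `h` to the negative half-line by the constant `h 0`. -/
def clamp {E : Type*} (h : ℝ → E) (t : ℝ) : E := h (max t 0)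

theorem clamp_of_nonneg {E : Type*} (h : ℝ → E) {t : ℝ} (ht : 0 ≤ t) : clamp h t = h t := by
  simp [clamp, ht]

/-- The data are continuous only on `[0,∞)`. Convolutions at `t ≥ 0` see only values on `[0,t]`, so
passing to extensions continuous on the whole line costs nothing. -/
theorem continuous_clamp {E : Type*} [TopologicalSpace E] {h : ℝ → E}
    (hh : ContinuousOn h (Ici 0)) : Continuous (clamp h) :=
  hh.comp_continuous (by fun_prop) fun t => le_max_right t 0

/-! ### Algebra of the Volterra convolution -/

section Conv

variable {E : Type*} [NormedAddCommGroup E] [NormedSpace ℝ E]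

theorem volterraConv_congr {k k' : ℝ → ℝ} {v v' : ℝ → E} {t : ℝ} (ht : 0 ≤ t)
    (hk : ∀ s, 0 ≤ s → s ≤ t → k s = k' s) (hv : ∀ s, 0 ≤ s → s ≤ t → v s = v' s) :
    volterraConv k v t = volterraConv k' v' t := by
  refine intervalIntegral.integral_congr fun s hs => ?_
  rw [uIcc_of_le ht] at hs
  rw [hk _ (by linarith [hs.2]) (by linarith [hs.1]), hv _ hs.1 hs.2]

theorem continuous_volterraConv {k : ℝ → ℝ} {v : ℝ → E} (hk : Continuous k) (hv : Continuous v) :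
    Continuous (volterraConv k v) := by
  unfold volterraConv
  exact intervalIntegral.continuous_parametric_intervalIntegral_of_continuous
    (f := fun t s => k (t - s) • v s) (by unfold Function.uncurry; fun_prop) continuous_id

theorem volterraConv_flip (k : ℝ → ℝ) (v : ℝ → E) (t : ℝ) :
    volterraConv k v t = ∫ s in (0 : ℝ)..t, k s • v (t - s) := by
  have := intervalIntegral.integral_comp_sub_left (a := 0) (b := t)
    (fun s => k (t - s) • v s) t
  simp only [sub_sub_cancel, sub_self, sub_zero] at this
  exact this.symm

theorem volterraConv_comm (k l : ℝ → ℝ) (t : ℝ) : volterraConv k l t = volterraConv l k t := by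
  rw [volterraConv_flip]
  simp only [volterraConv, smul_eq_mul, mul_comm]

theorem volterraConv_add_right {k : ℝ → ℝ} {v w : ℝ → E} (hk : Continuous k) (hv : Continuous v)
    (hw : Continuous w) (t : ℝ) :
    volterraConv k (fun s => v s + w s) t = volterraConv k v t + volterraConv k w t := by
  simp only [volterraConv, smul_add]
  exact intervalIntegral.integral_add (Continuous.intervalIntegrable (by fun_prop) _ _)
    (Continuous.intervalIntegrable (by fun_prop) _ _)

theorem volterraConv_smul_right (k : ℝ → ℝ) (c : ℝ) (v : ℝ → E) (t : ℝ) :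
    volterraConv k (fun s => c • v s) t = c • volterraConv k v t := by
  simp only [volterraConv, smul_comm _ c]
  exact intervalIntegral.integral_smul _ _

/-- Lets coefficients and total be taken after convolving in `L²`, so that no series is ever
integrated term by term. -/
theorem map_volterraConv [CompleteSpace E] {F : Type*} [NormedAddCommGroup F] [NormedSpace ℝ F]
    [CompleteSpace F] (T : E →L[ℝ] F) {k : ℝ → ℝ} {v : ℝ → E} (hk : Continuous k)
    (hv : Continuous v) (t : ℝ) :
    T (volterraConv k v t) = volterraConv k (fun s => T (v s)) t := by
  unfold volterraConv
  rw [← T.intervalIntegral_comp_comm (Continuous.intervalIntegrable (by fun_prop) _ _)]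
  simp only [map_smul]

theorem volterraConv_const_one (v : ℝ → E) (t : ℝ) :
    volterraConv (fun _ => 1) v t = ∫ s in (0 : ℝ)..t, v s := by
  simp [volterraConv]

/-- Extending the integrand by zero from the triangle `s + r ≤ t` to a square makes the domain
symmetric in the two variables, ready for Fubini. -/
theorem volterraConv_eq_indicator (k : ℝ → ℝ) {l m : ℝ → ℝ} {t : ℝ} (ht : 0 ≤ t) :
    volterraConv k (volterraConv l m) t = ∫ s in Ioc 0 t, ∫ r in Ioc 0 t,
      indicator {p : ℝ × ℝ | p.1 + p.2 ≤ t} (fun p => k p.1 * (l p.2 * m (t - p.1 - p.2)))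
        (s, r) := by
  rw [volterraConv_flip, intervalIntegral.integral_of_le ht]
  refine setIntegral_congr_fun measurableSet_Ioc fun s hs => ?_
  have hst : 0 ≤ t - s := by linarith [hs.2]
  simp only [smul_eq_mul]
  rw [volterraConv_flip, intervalIntegral.integral_of_le hst, ← integral_const_mul]
  have hsub : Ioc 0 (t - s) ⊆ Ioc 0 t := Ioc_subset_Ioc_right (by linarith [hs.1])
  rw [← integral_indicator measurableSet_Ioc, ← integral_indicator measurableSet_Ioc]
  congr 1
  ext r
  by_cases hr : r ∈ Ioc 0 (t - s)
  · have hmem : (s, r) ∈ {p : ℝ × ℝ | p.1 + p.2 ≤ t} := by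
      simp only [mem_ofPred_eq]; linarith [hr.2]
    rw [indicator_of_mem hr, indicator_of_mem (hsub hr), indicator_of_mem hmem]
    simp
  · rw [indicator_of_notMem hr]
    by_cases hr' : r ∈ Ioc 0 t
    · have hmem : (s, r) ∉ {p : ℝ × ℝ | p.1 + p.2 ≤ t} := by
        simp only [mem_ofPred_eq]
        intro h
        exact hr ⟨hr'.1, by linarith⟩
      rw [indicator_of_mem hr', indicator_of_notMem hmem]
    · rw [indicator_of_notMem hr']

/-- Fubini on the square, where exchanging `s` and `r` exchanges `k` and `l`. Associativity then
follows from commutativity. -/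
theorem volterraConv_left_comm {k l m : ℝ → ℝ} (hk : Continuous k) (hl : Continuous l)
    (hm : Continuous m) {t : ℝ} (ht : 0 ≤ t) :
    volterraConv k (volterraConv l m) t = volterraConv l (volterraConv k m) t := by
  rw [volterraConv_eq_indicator k ht, volterraConv_eq_indicator l ht, integral_integral_swap]
  · congr 1
    ext s
    congr 1
    ext r
    simp only [indicator, mem_ofPred_eq, add_comm r s]
    split_ifs
    · rw [sub_right_comm t r s]; ring
    · rfl
  · have hS : MeasurableSet {p : ℝ × ℝ | p.1 + p.2 ≤ t} :=
      measurableSet_le (by fun_prop) (by fun_prop)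
    have hc : Continuous fun p : ℝ × ℝ => k p.1 * (l p.2 * m (t - p.1 - p.2)) := by fun_prop
    have hi : IntegrableOn (fun p : ℝ × ℝ => k p.1 * (l p.2 * m (t - p.1 - p.2)))
        (Ioc 0 t ×ˢ Ioc 0 t) :=
      (hc.continuousOn.integrableOn_compact (isCompact_Icc.prod isCompact_Icc)).mono_set
        (prod_mono Ioc_subset_Icc_self Ioc_subset_Icc_self)
    rw [Measure.prod_restrict]
    exact Integrable.indicator hi hS

theorem volterraConv_assoc {k l m : ℝ → ℝ} (hk : Continuous k) (hl : Continuous l)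
    (hm : Continuous m) {t : ℝ} (ht : 0 ≤ t) :
    volterraConv (volterraConv k l) m t = volterraConv k (volterraConv l m) t := by
  rw [volterraConv_comm, volterraConv_left_comm hm hk hl ht]
  exact volterraConv_congr ht (fun _ _ _ => rfl) fun s _ _ => volterraConv_comm m l s

end Conv

/-! ### Uniqueness for equations of the second kind -/

/-- The homogeneous Volterra equation of the second kind has only the zero solution. -/
theorem eq_zero_of_add_volterraConv_eq_zero {k v : ℝ → ℝ} (hk : Continuous k) (hv : Continuous v)
    (h : ∀ t, 0 ≤ t → v t + volterraConv k v t = 0) {t : ℝ} (ht : 0 ≤ t) : v t = 0 := by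
  obtain ⟨M, hM⟩ := (isCompact_Icc (a := (0 : ℝ)) (b := t)).exists_bound_of_continuousOn
    hk.continuousOn
  have hbound : ∀ x ∈ Icc 0 t, |v x| ≤ M * ∫ s in (0 : ℝ)..x, |v s| := by
    intro x hx
    have hvx : v x = -volterraConv k v x := by linarith [h x hx.1]
    rw [hvx, abs_neg, ← intervalIntegral.integral_const_mul]
    change ‖∫ s in (0 : ℝ)..x, k (x - s) • v s‖ ≤ _
    refine intervalIntegral.norm_integral_le_of_norm_le (μ := volume) (g := fun s => M * |v s|)
      hx.1
      (Filter.Eventually.of_forall ?_) ((continuous_const.mul hv.abs).intervalIntegrable 0 x)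
    intro s hs
    rw [norm_smul, Real.norm_eq_abs (v s)]
    exact mul_le_mul_of_nonneg_right (hM _ ⟨by linarith [hs.2], by linarith [hs.1, hx.2]⟩)
      (abs_nonneg _)
  have hder : ∀ x, HasDerivAt (fun y => ∫ s in (0 : ℝ)..y, |v s|) |v x| x := fun x =>
    intervalIntegral.integral_hasDerivAt_right (hv.abs.intervalIntegrable _ _)
      hv.abs.aestronglyMeasurable.stronglyMeasurableAtFilter hv.abs.continuousAt
  have hnn : ∀ x, 0 ≤ x → 0 ≤ ∫ s in (0 : ℝ)..x, |v s| := fun x hx =>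
    intervalIntegral.integral_nonneg hx fun _ _ => abs_nonneg _
  -- Gronwall is applied to the primitive of `|v|`: it vanishes at `0`, and its derivative is at
  -- most `M` times itself.
  have hG := norm_le_gronwallBound_of_norm_deriv_right_le (δ := 0) (K := M) (ε := 0)
    (a := 0) (b := t) (fun x _ => (hder x).continuousAt.continuousWithinAt)
    (fun x _ => (hder x).hasDerivWithinAt) (by simp)
    (fun x hx => by
      rw [Real.norm_eq_abs, abs_abs, Real.norm_of_nonneg (hnn x hx.1), add_zero]
      exact hbound x ⟨hx.1, hx.2.le⟩) t ⟨ht, le_rfl⟩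
  rw [gronwallBound_ε0_δ0] at hG
  have h0 : ∫ s in (0 : ℝ)..t, |v s| = 0 := norm_le_zero_iff.1 hG
  have := hbound t ⟨ht, le_rfl⟩
  rw [h0, mul_zero] at this
  exact abs_eq_zero.1 (le_antisymm this (abs_nonneg _))

theorem eq_of_add_volterraConv_eq {k v w : ℝ → ℝ} (hk : Continuous k) (hv : Continuous v)
    (hw : Continuous w)
    (h : ∀ t, 0 ≤ t → v t + volterraConv k v t = w t + volterraConv k w t) {t : ℝ}
    (ht : 0 ≤ t) : v t = w t := by
  have := eq_zero_of_add_volterraConv_eq_zero hk (v := fun s => v s + (-1 : ℝ) • w s)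
    (by fun_prop) (fun s hs => by
      rw [volterraConv_add_right hk hv (by fun_prop), volterraConv_smul_right]
      simp only [smul_eq_mul]
      linarith [h s hs]) ht
  simp only [smul_eq_mul] at this
  linarith

theorem eq_add_integral_of_hasDerivWithinAt_Ici {y G : ℝ → ℝ} (hG : Continuous G)
    (h : ∀ t, 0 ≤ t → HasDerivWithinAt y (G t) (Ici 0) t) {t : ℝ} (ht : 0 ≤ t) :
    y t = y 0 + ∫ s in (0 : ℝ)..t, G s := by
  rw [intervalIntegral.integral_eq_sub_of_hasDeriv_right_of_le ht (f := y)
    (fun s hs => (h s hs.1).continuousWithinAt.mono Icc_subset_Ici_self)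
    (fun s hs => (h s hs.1.le).mono fun r hr => hs.1.le.trans (le_of_lt hr))
    (hG.intervalIntegrable _ _)]
  ring

/-! ### The scalar equation of one mode -/

/-- The kernel `β + μ² (1 * a)` of the Volterra equation for a single mode. -/
def modeKernel (a β : ℝ → ℝ) (μ : ℝ) (t : ℝ) : ℝ := β t + μ ^ 2 • volterraConv (fun _ => 1) a t

theorem continuous_modeKernel {a β : ℝ → ℝ} (ha : Continuous a) (hβ : Continuous β) (μ : ℝ) :
    Continuous (modeKernel a β μ) := by
  have := continuous_volterraConv (continuous_const (y := (1 : ℝ))) ha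
  unfold modeKernel
  fun_prop

theorem volterraConv_modeKernel {a β u : ℝ → ℝ} (ha : Continuous a) (hβ : Continuous β)
    (hu : Continuous u) (μ t : ℝ) :
    volterraConv (modeKernel a β μ) u t = volterraConv β u t
      + μ ^ 2 * volterraConv (volterraConv (fun _ => 1) a) u t := by
  have hA := continuous_volterraConv (continuous_const (y := (1 : ℝ))) ha
  rw [volterraConv_comm]
  unfold modeKernel
  rw [volterraConv_add_right hu hβ (by fun_prop), volterraConv_smul_right, volterraConv_comm u β,
    volterraConv_comm u, smul_eq_mul]

/-- The balance law for one mode, integrated in time: a Volterra equation of the second kind. -/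
theorem add_volterraConv_modeKernel {a β u p : ℝ → ℝ} (ha : ContinuousOn a (Ici 0))
    (hβ : ContinuousOn β (Ici 0)) (hu : ContinuousOn u (Ici 0)) (hp : ContinuousOn p (Ici 0))
    {μ : ℝ} (h : ∀ t, 0 ≤ t → HasDerivWithinAt
      (fun τ : ℝ => u τ + ∫ s in (0 : ℝ)..τ, β (τ - s) * u s)
      (∫ s in (0 : ℝ)..t, a (t - s) * (-μ ^ 2 * u s + p s)) (Ici 0) t) {t : ℝ} (ht : 0 ≤ t) :
    clamp u t + volterraConv (modeKernel (clamp a) (clamp β) μ) (clamp u) t =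
      u 0 + volterraConv (volterraConv (fun _ => 1) (clamp a)) (clamp p) t := by
  have ha' := continuous_clamp ha
  have hβ' := continuous_clamp hβ
  have hu' := continuous_clamp hu
  have hp' := continuous_clamp hp
  have hA := continuous_volterraConv (continuous_const (y := (1 : ℝ))) ha'
  have hsrc : Continuous fun s => (-μ ^ 2) • clamp u s + clamp p s := by fun_prop
  have hG := continuous_volterraConv ha' hsrc
  have key := eq_add_integral_of_hasDerivWithinAt_Ici hG (fun s hs => by
    refine (h s hs).congr_deriv ?_
    exact volterraConv_congr hs (fun r hr _ => (clamp_of_nonneg a hr).symm)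
      fun r hr _ => by rw [clamp_of_nonneg u hr, clamp_of_nonneg p hr, smul_eq_mul]) ht
  have hconv : ∫ s in (0 : ℝ)..t, β (t - s) * u s = volterraConv (clamp β) (clamp u) t :=
    volterraConv_congr ht (fun r hr _ => (clamp_of_nonneg β hr).symm)
      fun r hr _ => (clamp_of_nonneg u hr).symm
  -- Time integration is convolution with `1`; associativity moves that `1` onto `a`.
  rw [intervalIntegral.integral_same, add_zero, hconv, ← volterraConv_const_one,
    ← volterraConv_assoc continuous_const ha' hsrc ht,
    volterraConv_add_right hA (by fun_prop) hp', volterraConv_smul_right] at key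
  rw [volterraConv_modeKernel ha' hβ' hu', clamp_of_nonneg u ht]
  simp only [smul_eq_mul] at key
  linarith

/-- The response of a mode to a boundary input `f = 1 * g`, expressed through the free mode `u`. -/
theorem forced_mode_eq {a β g u w f : ℝ → ℝ} {μ c : ℝ} (hμ : μ ≠ 0) (ha : Continuous a)
    (hβ : Continuous β) (hg : Continuous g) (hu : Continuous u) (hw : Continuous w)
    (hf : ∀ t, 0 ≤ t → f t = ∫ s in (0 : ℝ)..t, g s)
    (hu_eq : ∀ t, 0 ≤ t → u t + volterraConv (modeKernel a β μ) u t = 1 / μ)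
    (hw_eq : ∀ t, 0 ≤ t → w t + volterraConv (modeKernel a β μ) w t =
      c * μ * volterraConv (volterraConv (fun _ => 1) a) f t) {t : ℝ} (ht : 0 ≤ t) :
    w t + c * (volterraConv g u t + volterraConv β (volterraConv g u) t) = c / μ * f t := by
  set A := volterraConv (fun _ => (1 : ℝ)) a
  have hA : Continuous A := continuous_volterraConv continuous_const ha
  have hK := continuous_modeKernel ha hβ μ
  set K := modeKernel a β μ
  have hgu := continuous_volterraConv hg hu
  have hKu := continuous_volterraConv hK hu
  have hgc : ∀ s, 0 ≤ s → volterraConv g (fun _ => 1 / μ) s = 1 / μ * f s := fun s hs => by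
    rw [hf s hs, volterraConv_comm]
    simp [volterraConv]
  have hgsum : ∀ s, 0 ≤ s →
      volterraConv g u s + volterraConv g (volterraConv K u) s = 1 / μ * f s := fun s hs => by
    rw [← volterraConv_add_right hg hu hKu, ← hgc s hs]
    exact volterraConv_congr hs (fun _ _ _ => rfl) fun r hr _ => hu_eq r hr
  have hW := continuous_volterraConv hA hgu
  -- The candidate is the free equation convolved with `g`, then with `c μ² A`: this gives the
  -- right-hand side `c μ² A * (f/μ) = c μ A * f`.
  have hsol : w t = (c * μ ^ 2) • volterraConv A (volterraConv g u) t := by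
    refine eq_of_add_volterraConv_eq
      (w := fun s => (c * μ ^ 2) • volterraConv A (volterraConv g u) s)
      hK hw (hW.const_smul (c * μ ^ 2)) (fun s hs => ?_) ht
    rw [hw_eq s hs, volterraConv_smul_right, volterraConv_left_comm hK hA hgu hs,
      volterraConv_congr (v' := volterraConv g (volterraConv K u)) hs (fun _ _ _ => rfl)
        fun r hr _ => volterraConv_left_comm hK hg hu hr,
      ← smul_add, ← volterraConv_add_right hA hgu (continuous_volterraConv hg hKu),
      volterraConv_congr (v' := fun r => (1 / μ) • f r) hs (fun _ _ _ => rfl)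
        fun r hr _ => hgsum r hr, volterraConv_smul_right]
    simp only [smul_eq_mul]
    field_simp
  -- Splitting `K` exposes the same `A * (g * u)` as in `hsol`, so it can be eliminated, and `a`
  -- with it.
  have h1 : volterraConv g (volterraConv K u) t =
      volterraConv β (volterraConv g u) t + μ ^ 2 * volterraConv A (volterraConv g u) t := by
    rw [← volterraConv_left_comm hK hg hu ht, volterraConv_modeKernel ha hβ hgu]
  have h2 := hgsum t ht
  rw [h1] at h2
  rw [hsol, smul_eq_mul]
  linear_combination c * h2

/-! ### Integrals and derivatives of the sine functions -/

theorem gamma0_sq {L : ℝ} (hL : 0 < L) : gamma0 L ^ 2 = 2 / L := Real.sq_sqrt (by positivity)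

theorem gamma0_pos {L : ℝ} (hL : 0 < L) : 0 < gamma0 L := Real.sqrt_pos.2 (by positivity)

theorem lam_pos {L : ℝ} (hL : 0 < L) {n : ℕ} (hn : 1 ≤ n) : 0 < lam L n := by
  have : (0 : ℝ) < n := by exact_mod_cast hn
  unfold lam
  positivity

theorem lam_mul_self {L : ℝ} (hL : 0 < L) (n : ℕ) : lam L n * L = n * Real.pi := by
  unfold lam
  field_simp

theorem setIntegral_phi {L : ℝ} (hL : 0 < L) {n : ℕ} (hn : 1 ≤ n) :
    ∫ x in Ioo (0 : ℝ) L, phi L n x = alpha L n / lam L n := by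
  have hl := (lam_pos hL hn).ne'
  rw [← integral_Ioc_eq_integral_Ioo, ← intervalIntegral.integral_of_le hL.le]
  unfold phi
  rw [intervalIntegral.integral_const_mul, intervalIntegral.integral_comp_mul_left _ hl,
    integral_sin, lam_mul_self hL, mul_zero, Real.cos_zero, Real.cos_nat_mul_pi]
  unfold alpha
  split_ifs with h
  · simp [h.neg_one_pow]
  · rw [Nat.not_even_iff_odd] at h
    rw [h.neg_one_pow, smul_eq_mul]
    field_simp
    ring

theorem integral_cos_int_mul {L : ℝ} (hL : 0 < L) (k : ℤ) :
    ∫ x in (0 : ℝ)..L, Real.cos (k * Real.pi / L * x) = if k = 0 then L else 0 := by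
  split_ifs with h
  · simp [h]
  · have hk : (k * Real.pi / L : ℝ) ≠ 0 := by
      have : (k : ℝ) ≠ 0 := by exact_mod_cast h
      positivity
    rw [intervalIntegral.integral_comp_mul_left _ hk, integral_cos, mul_zero, Real.sin_zero,
      div_mul_cancel₀ _ hL.ne', Real.sin_int_mul_pi]
    simp

theorem setIntegral_phi_mul_phi {L : ℝ} (hL : 0 < L) {n m : ℕ} (hn : 1 ≤ n) :
    ∫ x in Ioo (0 : ℝ) L, phi L n x * phi L m x = if n = m then 1 else 0 := by
  rw [← integral_Ioc_eq_integral_Ioo, ← intervalIntegral.integral_of_le hL.le]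
  have hprod : ∀ x, phi L n x * phi L m x = 1 / L *
      (Real.cos (((n - m : ℤ) : ℝ) * Real.pi / L * x)
        - Real.cos (((n + m : ℤ) : ℝ) * Real.pi / L * x)) := by
    intro x
    have e1 : ((n - m : ℤ) : ℝ) * Real.pi / L * x = lam L n * x - lam L m * x := by
      push_cast; unfold lam; ring
    have e2 : ((n + m : ℤ) : ℝ) * Real.pi / L * x = lam L n * x + lam L m * x := by
      push_cast; unfold lam; ring
    rw [e1, e2, Real.cos_sub, Real.cos_add]
    unfold phi
    linear_combination Real.sin (lam L n * x) * Real.sin (lam L m * x) * gamma0_sq hL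
  simp only [hprod]
  rw [intervalIntegral.integral_const_mul,
    intervalIntegral.integral_sub (Continuous.intervalIntegrable (by fun_prop) _ _)
      (Continuous.intervalIntegrable (by fun_prop) _ _),
    integral_cos_int_mul hL, integral_cos_int_mul hL, if_neg (by omega : ¬((n : ℤ) + m = 0))]
  by_cases h : n = m
  · simp [h, hL.ne']
  · rw [if_neg (by omega), if_neg h]
    simp

theorem continuous_phi (L : ℝ) (n : ℕ) : Continuous (phi L n) := by
  unfold phi
  fun_prop

theorem contDiff_phi (L : ℝ) (n : ℕ) : ContDiff ℝ 2 (phi L n) := by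
  unfold phi
  fun_prop

theorem phi_zero (L : ℝ) (n : ℕ) : phi L n 0 = 0 := by simp [phi]

theorem phi_right {L : ℝ} (hL : 0 < L) (n : ℕ) : phi L n L = 0 := by
  simp [phi, lam_mul_self hL]

theorem deriv_phi (L : ℝ) (n : ℕ) :
    deriv (phi L n) = fun x => gamma0 L * lam L n * Real.cos (lam L n * x) := by
  ext x
  have h := ((Real.hasDerivAt_sin (lam L n * x)).comp x
    ((hasDerivAt_id x).const_mul (lam L n))).const_mul (gamma0 L)
  exact h.deriv.trans (by ring)

theorem deriv_deriv_phi (L : ℝ) (n : ℕ) :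
    deriv (deriv (phi L n)) = fun x => -lam L n ^ 2 * phi L n x := by
  ext x
  rw [deriv_phi]
  have h := ((Real.hasDerivAt_cos (lam L n * x)).comp x
    ((hasDerivAt_id x).const_mul (lam L n))).const_mul (gamma0 L * lam L n)
  exact h.deriv.trans (by unfold phi; ring)

/-! ### The sine functions and the constant `1` in `L²(0,L)` -/

theorem memLp_of_bounded_continuous (L : ℝ) {h : ℝ → ℝ} (hc : Continuous h) {C : ℝ}
    (hC : ∀ x, |h x| ≤ C) : MemLp h 2 (volume.restrict (Ioo (0 : ℝ) L)) :=
  MemLp.of_bound hc.aestronglyMeasurable C (Filter.Eventually.of_forall hC)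

theorem memLp_phi (L : ℝ) (n : ℕ) : MemLp (phi L n) 2 (volume.restrict (Ioo (0 : ℝ) L)) := by
  refine memLp_of_bounded_continuous L (continuous_phi L n) (C := |gamma0 L|) fun x => ?_
  unfold phi
  rw [abs_mul]
  exact mul_le_of_le_one_right (abs_nonneg _) (Real.abs_sin_le_one _)

theorem memLp_one (L : ℝ) :
    MemLp (fun _ : ℝ => (1 : ℝ)) 2 (volume.restrict (Ioo (0 : ℝ) L)) := memLp_const 1

/-- The eigenfunction `φ_n` as an element of `L²(0,L)`. -/
def phiVec (L : ℝ) (n : ℕ) : L2 L := (memLp_phi L n).toLp _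

/-- The constant function `1` as an element of `L²(0,L)`. -/
def oneVec (L : ℝ) : L2 L := (memLp_one L).toLp _

theorem inner_toLp {L : ℝ} {h : ℝ → ℝ} (hh : MemLp h 2 (volume.restrict (Ioo (0 : ℝ) L)))
    (v : L2 L) : inner ℝ (hh.toLp h) v = pair L v h := by
  rw [L2.inner_def]
  refine integral_congr_ae ?_
  filter_upwards [hh.coeFn_toLp] with x hx
  rw [hx]
  rfl

theorem inner_phiVec (L : ℝ) (n : ℕ) (v : L2 L) : inner ℝ (phiVec L n) v = pair L v (phi L n) :=
  inner_toLp _ v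

theorem inner_oneVec (L : ℝ) (v : L2 L) : inner ℝ (oneVec L) v = total L v := by
  rw [oneVec, inner_toLp]
  simp [pair, total]

theorem pair_toLp {L : ℝ} {h : ℝ → ℝ} (hh : MemLp h 2 (volume.restrict (Ioo (0 : ℝ) L)))
    (ψ : ℝ → ℝ) : pair L (hh.toLp h) ψ = ∫ x in Ioo (0 : ℝ) L, h x * ψ x := by
  refine integral_congr_ae ?_
  filter_upwards [hh.coeFn_toLp] with x hx
  rw [hx]

theorem inner_phiVec_oneVec {L : ℝ} (hL : 0 < L) {n : ℕ} (hn : 1 ≤ n) :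
    inner ℝ (phiVec L n) (oneVec L) = alpha L n / lam L n := by
  rw [inner_phiVec, oneVec, pair_toLp, ← setIntegral_phi hL hn]
  simp

theorem orthonormal_phiVec {L : ℝ} (hL : 0 < L) :
    Orthonormal ℝ fun n : ℕ => phiVec L (n + 1) := by
  rw [orthonormal_iff_ite]
  intro n m
  rw [inner_phiVec, phiVec, pair_toLp]
  simp only [mul_comm (phi L (m + 1) _)]
  rw [setIntegral_phi_mul_phi hL (Nat.le_add_left 1 n)]
  simp

theorem norm_oneVec_sq {L : ℝ} (hL : 0 < L) : ‖oneVec L‖ ^ 2 = L := by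
  rw [← real_inner_self_eq_norm_sq, inner_oneVec, total, oneVec]
  rw [integral_congr_ae (memLp_one L).coeFn_toLp]
  simp [hL.le]

/-! ### The sine series of `1` and Parseval's identity -/

/-- The even terms contribute a quarter of `ζ(2)`, leaving three quarters of `π²/6`. -/
theorem hasSum_one_div_odd_sq :
    HasSum (fun n : ℕ => if Even n then 0 else 1 / (n : ℝ) ^ 2) (Real.pi ^ 2 / 8) := by
  have heven : HasSum (fun n : ℕ => if Even n then 1 / (n : ℝ) ^ 2 else 0)
      (1 / 4 * (Real.pi ^ 2 / 6)) := by
    rw [← (mul_right_injective₀ (two_ne_zero' ℕ)).hasSum_iff]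
    · convert! hasSum_zeta_two.mul_left (1 / 4) using 1
      funext n
      simp only [Function.comp_apply, even_two_mul, if_true]
      push_cast
      ring
    · intro n hn
      refine if_neg fun h => hn ?_
      obtain ⟨k, hk⟩ := h
      exact ⟨k, by simp only; omega⟩
  have := hasSum_zeta_two.sub heven
  rw [show Real.pi ^ 2 / 8 = Real.pi ^ 2 / 6 - 1 / 4 * (Real.pi ^ 2 / 6) by ring]
  convert! this using 1
  funext n
  split_ifs <;> simp

theorem hasSum_coeff_sq {L : ℝ} (hL : 0 < L) :
    HasSum (fun n : ℕ => (alpha L (n + 1) / lam L (n + 1)) ^ 2) L := by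
  -- For odd `n`, `(2γ₀/λ_n)² = (8L/π²)/n²`.
  have h := ((hasSum_nat_add_iff' 1).2 hasSum_one_div_odd_sq).mul_left (8 * L / Real.pi ^ 2)
  have hpi := Real.pi_pos.ne'
  have hL' := hL.ne'
  simp only [Finset.range_one, Finset.sum_singleton, Even.zero, if_true, sub_zero] at h
  rw [show 8 * L / Real.pi ^ 2 * (Real.pi ^ 2 / 8) = L by field_simp] at h
  convert! h using 1
  funext n
  unfold alpha lam
  split_ifs
  · simp
  · rw [div_pow, mul_pow, gamma0_sq hL]
    field_simp
    norm_num

/-- The sine series of the constant function `1` converges to it in `L²(0,L)`. -/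
theorem hasSum_phiVec_oneVec {L : ℝ} (hL : 0 < L) :
    HasSum (fun n : ℕ => (alpha L (n + 1) / lam L (n + 1)) • phiVec L (n + 1)) (oneVec L) := by
  have horth := orthonormal_phiVec hL
  -- The coefficients are those of `1`, so the squared error is `‖1‖²` minus the partial sum of
  -- squares, which tends to `L - L = 0`.
  have herr : ∀ s : Finset ℕ,
      ‖(∑ n ∈ s, (alpha L (n + 1) / lam L (n + 1)) • phiVec L (n + 1)) - oneVec L‖ ^ 2 =
        L - ∑ n ∈ s, (alpha L (n + 1) / lam L (n + 1)) ^ 2 := by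
    intro s
    have hself := horth.inner_sum (fun n => alpha L (n + 1) / lam L (n + 1))
      (fun n => alpha L (n + 1) / lam L (n + 1)) s
    rw [real_inner_self_eq_norm_sq] at hself
    rw [norm_sub_sq_real, hself, norm_oneVec_sq hL, sum_inner]
    simp only [real_inner_smul_left, inner_phiVec_oneVec hL (Nat.le_add_left 1 _), conj_trivial,
      sq]
    ring
  rw [HasSum, tendsto_iff_norm_sub_tendsto_zero]
  have hlim := (tendsto_const_nhds (x := L)).sub (hasSum_coeff_sq hL)
  rw [sub_self] at hlim
  have := hlim.sqrt
  rw [Real.sqrt_zero] at this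
  refine this.congr fun s => ?_
  rw [← herr s, Real.sqrt_sq (norm_nonneg _)]

/-- Parseval's identity for the integral of an `L²` function. -/
theorem hasSum_coeff_mul_pair {L : ℝ} (hL : 0 < L) (v : L2 L) :
    HasSum (fun n : ℕ => alpha L (n + 1) / lam L (n + 1) * pair L v (phi L (n + 1)))
      (total L v) := by
  have h := (innerSL ℝ v).hasSum (hasSum_phiVec_oneVec hL)
  rw [← inner_oneVec, real_inner_comm]
  refine Eq.mpr ?_ h
  congr 1
  funext n
  rw [innerSL_apply_apply, real_inner_smul_right, ← inner_phiVec, real_inner_comm]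

/-! ### From the modes to the measured quantities -/

theorem pair_const_mul (L : ℝ) (v : L2 L) (ψ : ℝ → ℝ) (c : ℝ) :
    pair L v (fun x => c * ψ x) = c * pair L v ψ := by
  unfold pair
  rw [← integral_const_mul]
  congr 1
  ext x
  ring

theorem pair_eq_innerSL (L : ℝ) (n : ℕ) (v : L2 L) :
    pair L v (phi L n) = innerSL ℝ (phiVec L n) v := by
  rw [innerSL_apply_apply, inner_phiVec]

theorem total_eq_innerSL (L : ℝ) (v : L2 L) : total L v = innerSL ℝ (oneVec L) v := by
  rw [innerSL_apply_apply, inner_oneVec]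

/-- The sine coefficients of a solution driven from the left end solve Volterra equations. -/
theorem IsSolution.mode_eq {L : ℝ} (hL : 0 < L) {a β : ℝ → ℝ} (ha : ContinuousOn a (Ici 0))
    (hβ : ContinuousOn β (Ici 0)) {ξ : L2 L} {p : ℝ → ℝ} (hp : ContinuousOn p (Ici 0))
    {θ : ℝ → L2 L} (hθ : IsSolution L a β ξ p (fun _ => 0) θ) (n : ℕ) {t : ℝ} (ht : 0 ≤ t) :
    pair L (clamp θ t) (phi L n)
      + volterraConv (modeKernel (clamp a) (clamp β) (lam L n))
          (fun s => pair L (clamp θ s) (phi L n)) t =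
      pair L ξ (phi L n) + gamma0 L * lam L n *
        volterraConv (volterraConv (fun _ => 1) (clamp a)) (clamp p) t := by
  have hu : ContinuousOn (fun s => pair L (θ s) (phi L n)) (Ici 0) := by
    simp only [pair_eq_innerSL]
    exact (innerSL ℝ (phiVec L n)).continuous.comp_continuousOn hθ.continuousOn
  have key := add_volterraConv_modeKernel ha hβ hu
    (p := fun s => (gamma0 L * lam L n) • p s) (by fun_prop) (μ := lam L n) (fun s hs => by
      refine (hθ.balance (phi L n) (contDiff_phi L n) (phi_zero L n) (phi_right hL n)
        s hs).congr_deriv ?_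
      refine intervalIntegral.integral_congr fun r _ => ?_
      rw [deriv_deriv_phi]
      simp only [pair_const_mul, deriv_phi, mul_zero, Real.cos_zero, smul_eq_mul]
      ring) ht
  rw [hθ.initial, show clamp (fun s => (gamma0 L * lam L n) • p s) =
    fun s => (gamma0 L * lam L n) • clamp p s from rfl, volterraConv_smul_right] at key
  exact key

theorem IsMode.mode_eq {a β : ℝ → ℝ} (ha : ContinuousOn a (Ici 0))
    (hβ : ContinuousOn β (Ici 0)) {μ : ℝ} {z : ℝ → ℝ} (hz : IsMode a β μ z) {t : ℝ} (ht : 0 ≤ t) :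
    clamp z t + volterraConv (modeKernel (clamp a) (clamp β) μ) (clamp z) t = 1 := by
  have key := add_volterraConv_modeKernel ha hβ hz.continuousOn (p := fun _ => 0)
    continuousOn_const (μ := μ) (fun s hs => by
      refine (hz.equation s hs).congr_deriv ?_
      rw [← intervalIntegral.integral_const_mul]
      congr 1
      ext r
      ring) ht
  rw [key, hz.initial]
  simp [volterraConv, clamp]

theorem volterraConv_clamp {g H : ℝ → ℝ} {v : ℝ → ℝ} (hH : ∀ t, 0 ≤ t → H t = v t) {t : ℝ}
    (ht : 0 ≤ t) : volterraConv (clamp g) v t = ∫ s in (0 : ℝ)..t, g (t - s) * H s :=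
  volterraConv_congr ht (fun _ hs _ => clamp_of_nonneg g hs) fun s hs _ => (hH s hs).symm

theorem continuous_pair_clamp {L : ℝ} {θ : ℝ → L2 L} (hθ : ContinuousOn θ (Ici 0)) (n : ℕ) :
    Continuous fun s => pair L (clamp θ s) (phi L n) := by
  simp only [pair_eq_innerSL]
  exact (innerSL ℝ (phiVec L n)).continuous.comp (continuous_clamp hθ)

/-- The series for the measurement of the first experiment. -/
theorem hasSum_total_free {L : ℝ} (hL : 0 < L) {a β : ℝ → ℝ} (ha : ContinuousOn a (Ici 0))
    (hβ : ContinuousOn β (Ici 0)) {ξ : L2 L}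
    (hξ : ∀ n : ℕ, 1 ≤ n → pair L ξ (phi L n) = 1 / lam L n) {θ : ℝ → L2 L}
    (hθ : IsSolution L a β ξ (fun _ => 0) (fun _ => 0) θ) {z : ℕ → ℝ → ℝ}
    (hz : ∀ n : ℕ, 1 ≤ n → IsMode a β (lam L n) (z n)) {t : ℝ} (ht : 0 ≤ t) :
    HasSum (fun n : ℕ => alpha L (n + 1) / lam L (n + 1) ^ 2 * z (n + 1) t)
      (total L (θ t)) := by
  have hmode : ∀ n : ℕ, 1 ≤ n → pair L (θ t) (phi L n) = (1 / lam L n) • z n t := by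
    intro n hn
    have hzc := continuous_clamp (hz n hn).continuousOn
    -- Both the coefficient and `z_n / λ_n` solve the equation with right-hand side `1/λ_n`.
    have key := eq_of_add_volterraConv_eq
      (continuous_modeKernel (continuous_clamp ha) (continuous_clamp hβ) (lam L n))
      (continuous_pair_clamp hθ.continuousOn n) (w := fun s => (1 / lam L n) • clamp (z n) s)
      (by fun_prop) (fun s hs => by
        rw [hθ.mode_eq hL ha hβ continuousOn_const n hs, volterraConv_smul_right, ← smul_add,
          (hz n hn).mode_eq ha hβ hs, hξ n hn]
        simp [volterraConv, clamp]) ht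
    rwa [clamp_of_nonneg θ ht, clamp_of_nonneg (z n) ht] at key
  convert! hasSum_coeff_mul_pair hL (θ t) using 1
  funext n
  rw [hmode (n + 1) (Nat.le_add_left 1 n), smul_eq_mul]
  have := (lam_pos hL (Nat.le_add_left 1 n)).ne'
  field_simp

theorem summable_alpha_div_lam_sq {L : ℝ} (hL : 0 < L) :
    Summable (fun n : ℕ => alpha L (n + 1) / lam L (n + 1) ^ 2) := by
  -- Since `α_n` is `0` or `2γ₀`, `α_n² = 2γ₀ α_n`, so each term is a fixed multiple of
  -- `(α_n/λ_n)²`.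
  convert! (hasSum_coeff_sq hL).summable.mul_left (1 / (2 * gamma0 L)) using 1
  funext n
  have := (gamma0_pos hL).ne'
  unfold alpha
  split_ifs
  · simp
  · field_simp

/-- The energy of the second experiment in terms of the measurement of the first one. -/
theorem total_forced_eq {L : ℝ} (hL : 0 < L) {a β : ℝ → ℝ} (ha : ContinuousOn a (Ici 0))
    (hβ : ContinuousOn β (Ici 0)) {ξ : L2 L}
    (hξ : ∀ n : ℕ, 1 ≤ n → pair L ξ (phi L n) = 1 / lam L n) {θ₁ θ₂ : ℝ → L2 L}
    (hθ₁ : IsSolution L a β ξ (fun _ => 0) (fun _ => 0) θ₁) {f g H : ℝ → ℝ}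
    (hH : ∀ t : ℝ, 0 ≤ t → H t = total L (θ₁ t)) (hg : ContinuousOn g (Ici 0))
    (hf : ∀ t : ℝ, 0 ≤ t → f t = ∫ s in (0 : ℝ)..t, g s)
    (hθ₂ : IsSolution L a β 0 f (fun _ => 0) θ₂) {t : ℝ} (ht : 0 ≤ t) :
    total L (θ₂ t) = gamma0 L *
      ((∫ s in (0 : ℝ)..t, g s) * (∑' n : ℕ, alpha L (n + 1) / lam L (n + 1) ^ 2)
        - (∫ s in (0 : ℝ)..t, g (t - s) * H s)
        - ∫ s in (0 : ℝ)..t, β s * ∫ r in (0 : ℝ)..(t - s), g (t - s - r) * H r) := by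
  have hg' := continuous_clamp hg
  have ha' := continuous_clamp ha
  have hβ' := continuous_clamp hβ
  have hθ₁' := continuous_clamp hθ₁.continuousOn
  have hgint : ∀ s, 0 ≤ s → f s = ∫ r in (0 : ℝ)..s, clamp g r := fun s hs => by
    rw [hf s hs]
    refine intervalIntegral.integral_congr fun r hr => ?_
    rw [uIcc_of_le hs] at hr
    exact (clamp_of_nonneg g hr.1).symm
  have hfc : ContinuousOn f (Ici 0) :=
    (intervalIntegral.continuous_primitive (fun _ _ => hg'.intervalIntegrable _ _)
      0).continuousOn.congr fun s hs => hgint s hs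
  have hG := continuous_volterraConv hg' hθ₁'
  set G := volterraConv (clamp g) (clamp θ₁) with hGdef
  -- By `forced_mode_eq` the sine coefficients of this combination are `γ₀ f(t)/λ_n`. Its total is
  -- then computed twice: by linearity (`htotal`) and by Parseval (`hsum`).
  set V : L2 L := θ₂ t + gamma0 L • (G t + volterraConv (clamp β) G t) with hV
  have hpair : ∀ n : ℕ, 1 ≤ n → pair L V (phi L n) = gamma0 L / lam L n * f t := by
    intro n hn
    have hlam := (lam_pos hL hn).ne'
    have key := forced_mode_eq (c := gamma0 L) (f := clamp f) hlam ha' hβ' hg'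
      (continuous_pair_clamp hθ₁.continuousOn n) (continuous_pair_clamp hθ₂.continuousOn n)
      (fun s hs => by rw [clamp_of_nonneg f hs, hgint s hs])
      (fun s hs => by
        rw [hθ₁.mode_eq hL ha hβ continuousOn_const n hs, hξ n hn]
        simp [volterraConv, clamp])
      (fun s hs => by
        rw [hθ₂.mode_eq hL ha hβ hfc n hs, pair_eq_innerSL, map_zero, zero_add]) ht
    rw [clamp_of_nonneg f ht, clamp_of_nonneg θ₂ ht] at key
    rw [← key, hV, pair_eq_innerSL, map_add, map_smul, map_add,
      map_volterraConv _ hβ' hG, hGdef, map_volterraConv _ hg' hθ₁']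
    simp only [map_volterraConv _ hg' hθ₁', ← pair_eq_innerSL, smul_eq_mul]
  have htotal : total L V = total L (θ₂ t) + gamma0 L * ((∫ s in (0 : ℝ)..t, g (t - s) * H s)
      + ∫ s in (0 : ℝ)..t, β s * ∫ r in (0 : ℝ)..(t - s), g (t - s - r) * H r) := by
    have hconv : ∀ s, 0 ≤ s → ∫ r in (0 : ℝ)..s, g (s - r) * H r =
        volterraConv (clamp g) (fun r => total L (clamp θ₁ r)) s := fun s hs =>
      (volterraConv_clamp (fun r hr => by rw [hH r hr, clamp_of_nonneg θ₁ hr]) hs).symm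
    have hconv2 : ∫ s in (0 : ℝ)..t, β s * ∫ r in (0 : ℝ)..(t - s), g (t - s - r) * H r =
        volterraConv (clamp β) (volterraConv (clamp g) fun r => total L (clamp θ₁ r)) t := by
      rw [volterraConv_flip]
      refine intervalIntegral.integral_congr fun s hs => ?_
      rw [uIcc_of_le ht] at hs
      simp only [smul_eq_mul]
      rw [hconv (t - s) (by linarith [hs.2]), clamp_of_nonneg β hs.1]
    rw [hconv t ht, hconv2, hV, total_eq_innerSL, map_add, map_smul, map_add,
      map_volterraConv _ hβ' hG, hGdef, map_volterraConv _ hg' hθ₁']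
    simp only [map_volterraConv _ hg' hθ₁', ← total_eq_innerSL, smul_eq_mul]
  have hsum : total L V =
      gamma0 L * f t * ∑' n : ℕ, alpha L (n + 1) / lam L (n + 1) ^ 2 := by
    refine (hasSum_coeff_mul_pair hL V).unique ?_
    convert! (summable_alpha_div_lam_sq hL).hasSum.mul_left (gamma0 L * f t) using 1
    funext n
    rw [hpair (n + 1) (Nat.le_add_left 1 n)]
    have := (lam_pos hL (Nat.le_add_left 1 n)).ne'
    field_simp
  rw [← hf t ht]
  linear_combination hsum - htotal

end

end GurtinPipkin

theorem mainTheorem1 (L : ℝ) (hL : 0 < L)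
    (a β : ℝ → ℝ) (ha : GurtinPipkin.IsKernel a) (hβ : GurtinPipkin.IsKernel β) (ha0 : 0 < a 0)
    -- first experiment: special initial datum, zero boundary temperatures; measurement `H`
    (ξ : GurtinPipkin.L2 L)
    (hξ : ∀ n : ℕ, 1 ≤ n →
      GurtinPipkin.pair L ξ (GurtinPipkin.phi L n) = 1 / GurtinPipkin.lam L n)
    (θ₁ : ℝ → GurtinPipkin.L2 L)
    (hθ₁ : GurtinPipkin.IsSolution L a β ξ (fun _ => 0) (fun _ => 0) θ₁)
    (H : ℝ → ℝ) (hH : ∀ t : ℝ, 0 ≤ t → H t = GurtinPipkin.total L (θ₁ t))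
    -- second experiment: zero initial datum, boundary temperature `f`; measurement `Θ`
    (f g : ℝ → ℝ) (hg : ContinuousOn g (Ici 0))
    (hf : ∀ t : ℝ, 0 ≤ t → f t = ∫ s in (0 : ℝ)..t, g s)
    (θ₂ : ℝ → GurtinPipkin.L2 L)
    (hθ₂ : GurtinPipkin.IsSolution L a β 0 f (fun _ => 0) θ₂)
    (Θ : ℝ → ℝ) (hΘ : ∀ t : ℝ, 0 ≤ t → Θ t = GurtinPipkin.total L (θ₂ t)) :
    -- the coefficients `α_n`
    (∀ n : ℕ, 1 ≤ n → ∫ x in Ioo (0 : ℝ) L, GurtinPipkin.phi L n x =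
      GurtinPipkin.alpha L n / GurtinPipkin.lam L n) ∧
    -- the series for `H`
    (∀ z : ℕ → ℝ → ℝ,
      (∀ n : ℕ, 1 ≤ n → GurtinPipkin.IsMode a β (GurtinPipkin.lam L n) (z n)) →
      ∀ t : ℝ, 0 ≤ t →
        HasSum (fun n : ℕ => GurtinPipkin.alpha L (n + 1) / GurtinPipkin.lam L (n + 1) ^ 2
          * z (n + 1) t) (H t)) ∧
    -- the identity for the measured energy
    Summable (fun n : ℕ => GurtinPipkin.alpha L (n + 1) / GurtinPipkin.lam L (n + 1) ^ 2) ∧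
    (∀ t : ℝ, 0 ≤ t →
      Θ t = GurtinPipkin.gamma0 L *
        ((∫ s in (0 : ℝ)..t, g s) *
            (∑' n : ℕ, GurtinPipkin.alpha L (n + 1) / GurtinPipkin.lam L (n + 1) ^ 2)
          - (∫ s in (0 : ℝ)..t, g (t - s) * H s)
          - ∫ s in (0 : ℝ)..t, β s * ∫ r in (0 : ℝ)..(t - s), g (t - s - r) * H r)) ∧
    -- the deconvolution problem for `β`
    (∀ t : ℝ, 0 ≤ t →
      ∫ s in (0 : ℝ)..t, β s * (∫ r in (0 : ℝ)..(t - s), g (t - s - r) * H r) =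
        GurtinPipkin.knownFunction L g H Θ t) := by
  have hΘ_eq : ∀ t : ℝ, 0 ≤ t → _ := fun t ht => (hΘ t ht).trans
    (GurtinPipkin.total_forced_eq hL ha.contDiffOn.continuousOn hβ.contDiffOn.continuousOn hξ hθ₁
      hH hg hf hθ₂ ht)
  refine ⟨fun n hn => GurtinPipkin.setIntegral_phi hL hn, fun z hz t ht => ?_,
    GurtinPipkin.summable_alpha_div_lam_sq hL, hΘ_eq, fun t ht => ?_⟩
  · rw [hH t ht]
    exact GurtinPipkin.hasSum_total_free hL ha.contDiffOn.continuousOn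
      hβ.contDiffOn.continuousOn hξ hθ₁ hz ht
  · have hγ := (GurtinPipkin.gamma0_pos hL).ne'
    rw [GurtinPipkin.knownFunction, hΘ_eq t ht]
    field_simp
    ring
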